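/- Let $\{\nu_\varepsilon\}_{\varepsilon>0}$ be a family of nonzero positive Borel measures on $\mathbb{R}^d$ with $$\int_{\mathbb{R}^d}(1\wedge|x|)\,\nu_\varepsilon(\mathrm{d}x)<\infty\quad\text{and}\quad \nu_\varepsilon(\{0\})=0 .$$ For $\varepsilon>0$ let $R_\varepsilon\in[1,\infty]$ and put $$C_\varepsilon=\int_{\mathbb{R}^d}(R_\varepsilon\wedge|x|)\,\nu_\varepsilon(\mathrm{d}x),\qquad \lambda_\varepsilon(\mathrm{d}x)=C_\varepsilon^{-1}(R_\varepsilon\wedge|x|)\,\nu_\varepsilon(\mathrm{d}x),$$ where $C_\varepsilon<\infty$ is assumed (this is automatic if $R_\varepsilon<\infty$), so that $\lambda_\varepsilon$ is a probability measure. Let $\mu_\varepsilon$ be the probability measure on the unit sphere $\mathbb{S}^{d-1}$ given by $\mu_\varepsilon(A)=\lambda_\varepsilon(\{r\theta: r>0,\ \theta\in A\})$ for Borel $A\subset\mathbb{S}^{d-1}$. Assume that $$\lim_{\varepsilon\downarrow0}\lambda_\varepsilon(\{x:|x|>r\})=0\quad\text{for every } r>0 .$$ Then there exist a sequence $\varepsilon_j>0$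 converging to $0$ and a probability measure $\mu$ on $\mathbb{S}^{d-1}$ such that $\mu_{\varepsilon_j}\to\mu$ weakly and, for every $f\in\mathrm{BV}(\mathbb{R}^d)$, $$\lim_{j\to\infty}C_{\varepsilon_j}^{-1}\mathcal{F}_{\nu_{\varepsilon_j}}(f)=\frac12\int_{\mathbb{S}^{d-1}}\int_{\mathbb{R}^d}|Df\cdot\theta|\,\mu(\mathrm{d}\theta).$$ Here $$\mathcal{F}_\nu(f)=\frac12\int_{\mathbb{R}^d}\int_{\mathbb{R}^d}|f(x+y)-f(y)|\,\nu(\mathrm{d}x)\,\mathrm{d}y ;$$ $\mathrm{BV}(\mathbb{R}^d)$ is the set of real-valued $f\in L^1(\mathbb{R}^d)$ for which the supremum of $\int f\,\mathrm{div}\,v\,\mathrm{d}x$ over all $v\in C_c^\infty(\mathbb{R}^d,\mathbb{R}^d)$ with $|v|\le1$ is finite; $Df$ is the $\mathbb{R}^d$-valued Borel measure that is the distributional gradient of $f$ (part of the claim is that it exists), that is, $\int f\,\nabla\varphi\,\mathrm{d}x=-\int\varphi\,\mathrm{d}(Df)$ for all $\varphi\in C_c^\infty(\mathbb{R}^d)$;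 and $\int_{\mathbb{R}^d}|Df\cdot\theta|$ is the total variation of the signed measure $A\mapsto Df(A)\cdot\theta$ on $\mathbb{R}^d$. -/

import Mathlib

open MeasureTheory Filter Set
open scoped ENNReal Topology Pointwise

noncomputable section

/-- The divergence `∑ i, ∂ v_i / ∂ x_i` of a vector field on `ℝ^d`. -/
def divergence {d : ℕ} (v : EuclideanSpace ℝ (Fin d) → EuclideanSpace ℝ (Fin d))
    (x : EuclideanSpace ℝ (Fin d)) : ℝ :=
  ∑ i : Fin d, (fderiv ℝ v x (EuclideanSpace.single i 1)) i

/-- The total variation `|Du|(ℝ^d)`: the supremum of `∫ u div v` over all `v ∈ C_c^∞(ℝ^d, ℝ^d)` with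
`|v| ≤ 1` everywhere. (The class of `v` is invariant under `v ↦ -v`, so clipping negative
integrals to `0` does not change the supremum.) -/
def gradVariation {d : ℕ} (u : EuclideanSpace ℝ (Fin d) → ℝ) : ℝ≥0∞ :=
  ⨆ (v : EuclideanSpace ℝ (Fin d) → EuclideanSpace ℝ (Fin d)) (_ : ContDiff ℝ ((⊤ : ℕ∞) : WithTop ℕ∞) v)
    (_ : HasCompactSupport v) (_ : ∀ x, ‖v x‖ ≤ 1), ENNReal.ofReal (∫ x, u x * divergence v x)

/-- `u ∈ BV(ℝ^d)`: `u ∈ L¹(ℝ^d)` and `|Du|(ℝ^d) < ∞`. -/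
def IsBV {d : ℕ} (u : EuclideanSpace ℝ (Fin d) → ℝ) : Prop :=
  Integrable u ∧ gradVariation u < ⊤

/-- The `ℝ^d`-valued (finite, countably additive) Borel measure `Λ` is the distributional gradient
`Du` of `u`: `∫ u ∇φ dx = - ∫ φ dΛ` (an identity in `ℝ^d`) for every `φ ∈ C_c^∞(ℝ^d)`. -/
def IsDistribGradient {d : ℕ} (u : EuclideanSpace ℝ (Fin d) → ℝ)
    (Λ : VectorMeasure (EuclideanSpace ℝ (Fin d)) (EuclideanSpace ℝ (Fin d))) : Prop :=
  ∀ φ : EuclideanSpace ℝ (Fin d) → ℝ, ContDiff ℝ ((⊤ : ℕ∞) : WithTop ℕ∞) φ → HasCompactSupport φ →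
    ∫ x, u x • gradient φ x = - ∫ᵛ x, φ x ∂•Λ

/-- The signed measure `Λ · θ`, that is `A ↦ ⟪θ, Λ A⟫`. -/
def dotMeasure {d : ℕ}
    (Λ : VectorMeasure (EuclideanSpace ℝ (Fin d)) (EuclideanSpace ℝ (Fin d)))
    (θ : EuclideanSpace ℝ (Fin d)) : SignedMeasure (EuclideanSpace ℝ (Fin d)) :=
  Λ.mapRange (innerSL ℝ θ).toLinearMap.toAddMonoidHom (innerSL ℝ θ).continuous

/-- `∫_{ℝ^d} |Λ · θ|`, the mass of the total variation measure of `Λ · θ`. -/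
def dotVariation {d : ℕ}
    (Λ : VectorMeasure (EuclideanSpace ℝ (Fin d)) (EuclideanSpace ℝ (Fin d)))
    (θ : EuclideanSpace ℝ (Fin d)) : ℝ≥0∞ :=
  (dotMeasure Λ θ).variation univ

/-- `∫ (1 ∧ |x|) ν(dx) < ∞` and `ν({0}) = 0`. -/
def IsAdmissible {d : ℕ} (ν : Measure (EuclideanSpace ℝ (Fin d))) : Prop :=
  ∫⁻ x, min 1 ‖x‖ₑ ∂ν < ⊤ ∧ ν {0} = 0

/-- `F_ν(u) = (1/2) ∫ ∫ |u(x + y) - u(y)| ν(dx) dy`. -/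
def nonlocalEnergy {d : ℕ} (ν : Measure (EuclideanSpace ℝ (Fin d)))
    (u : EuclideanSpace ℝ (Fin d) → ℝ) : ℝ≥0∞ :=
  2⁻¹ * ∫⁻ y, ∫⁻ x, ‖u (x + y) - u y‖ₑ ∂ν

/-- The normalizing constant `∫ (R ∧ |x|) ν(dx)`, where `R ∈ [0, ∞]`. -/
def normConst {d : ℕ} (R : ℝ≥0∞) (ν : Measure (EuclideanSpace ℝ (Fin d))) : ℝ≥0∞ :=
  ∫⁻ x, min R ‖x‖ₑ ∂ν

/-- The normalized measure `C⁻¹ (R ∧ |x|) ν(dx)` with `C = ∫ (R ∧ |x|) ν(dx)`. -/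
def normalizedMeasure {d : ℕ} (R : ℝ≥0∞) (ν : Measure (EuclideanSpace ℝ (Fin d))) :
    Measure (EuclideanSpace ℝ (Fin d)) :=
  (normConst R ν)⁻¹ • ν.withDensity (fun x => min R ‖x‖ₑ)

/-- The image on the unit sphere of the restriction of `lam` to `ℝ^d ∖ {0}` under `x ↦ x / |x|`. -/
def sphereProjection {d : ℕ} (lam : Measure (EuclideanSpace ℝ (Fin d))) :
    Measure (Metric.sphere (0 : EuclideanSpace ℝ (Fin d)) 1) :=
  (lam.comap ((↑) : ({0}ᶜ : Set (EuclideanSpace ℝ (Fin d))) → EuclideanSpace ℝ (Fin d))).map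
    (fun x => (homeomorphUnitSphereProd (EuclideanSpace ℝ (Fin d)) x).1)

/-- The projection to the sphere gives to `A` the mass of the cone `(0, ∞) A`. -/
theorem sphereProjection_apply {d : ℕ} (lam : Measure (EuclideanSpace ℝ (Fin d)))
    {A : Set (Metric.sphere (0 : EuclideanSpace ℝ (Fin d)) 1)} (hA : MeasurableSet A) :
    sphereProjection lam A =
      lam (Ioi (0 : ℝ) • (((↑) : _ → EuclideanSpace ℝ (Fin d)) '' A)) := by
  have hm : Measurable (fun x : ({0}ᶜ : Set (EuclideanSpace ℝ (Fin d))) =>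
      (homeomorphUnitSphereProd (EuclideanSpace ℝ (Fin d)) x).1) := by fun_prop
  rw [sphereProjection, Measure.map_apply hm hA,
    (MeasurableEmbedding.subtype_coe (measurableSet_singleton _).compl).comap_apply]
  congr 1
  ext x
  simp only [mem_image, mem_preimage, Set.mem_smul]
  constructor
  · rintro ⟨y, hy, rfl⟩
    refine ⟨‖(y : EuclideanSpace ℝ (Fin d))‖, norm_pos_iff.2 y.2, _, ⟨_, hy, rfl⟩, ?_⟩
    rw [homeomorphUnitSphereProd_apply_fst_coe]
    exact smul_inv_smul₀ (norm_ne_zero_iff.2 y.2) _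
  · rintro ⟨r, hr, _, ⟨e, he, rfl⟩, rfl⟩
    have he1 : ‖(e : EuclideanSpace ℝ (Fin d))‖ = 1 := by simp
    have hne : r • (e : EuclideanSpace ℝ (Fin d)) ≠ 0 :=
      smul_ne_zero (ne_of_gt hr) (by rw [← norm_ne_zero_iff, he1]; exact one_ne_zero)
    refine ⟨⟨_, mem_compl_singleton_iff.2 hne⟩, ?_, rfl⟩
    convert he
    apply Subtype.ext
    rw [homeomorphUnitSphereProd_apply_fst_coe]
    change ‖r • (e : EuclideanSpace ℝ (Fin d))‖⁻¹ • r • (e : EuclideanSpace ℝ (Fin d)) = _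
    rw [norm_smul, he1, Real.norm_of_nonneg (le_of_lt hr),
      mul_one, inv_smul_smul₀ (ne_of_gt hr)]

end

/-! Let V(v) be `dirVariation` and G(v) be `translationIncrement`, the L¹ norm of f(· + v) - f. By
Tonelli the energy is half of ∫ G dν, so everything rests on comparing G with V. On one side G ≤ V,
by L¹ duality with test functions and a mean value inequality
(`translationIncrement_le_dirVariation`). On the other, V(v) ≤ G(v) + η|v| for small |v|: a nearly
optimal test function gives this along one ray, and compactness of the sphere with the Lipschitz
bounds on V and G makes it uniform in the direction (`exists_dirVariation_le`).

V is positively homogeneous and, as R ≥ 1, the weight R ∧ |x| equals |x| near 0. Hence C⁻¹ ∫ G dν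
and the integral of V over the sphere against the projected measure differ by at most η plus a
constant times the λ-mass of {|x| > δ}, which tends to 0 (`lintegral_translationIncrement_le`,
`lintegral_dirVariation_le`). V is continuous on the compact sphere, so a weakly convergent
subsequence of the projections gives the limit.

It remains to see that V(v) is the total variation of Df · v. The gradient is built from vague
limits of difference quotients, which V bounds in L¹ (`HasDirVariationBound.exists_measure_sub`); it
has a vector density h, and duality gives V(v) = ∫ |h · v| (`IsBV.exists_isDistribGradient`). -/

open scoped CompactlySupported

/-! ### Test functions with values in [-1, 1] -/

/-- Smooth compactly supported functions with values in `[-1, 1]`. -/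
structure IsUnitTestFunction {E : Type*} [NormedAddCommGroup E] [NormedSpace ℝ E]
    (φ : E → ℝ) : Prop where
  contDiff : ContDiff ℝ ((⊤ : ℕ∞) : WithTop ℕ∞) φ
  hasCompactSupport : HasCompactSupport φ
  abs_le_one : ∀ x, |φ x| ≤ 1

theorem MeasureTheory.Integrable.mul_fderiv {E : Type*} [NormedAddCommGroup E] [NormedSpace ℝ E]
    [MeasurableSpace E] [OpensMeasurableSpace E] [SecondCountableTopology E] {m : Measure E}
    {g φ : E → ℝ} (hg : Integrable g m) (hφ : ContDiff ℝ ((⊤ : ℕ∞) : WithTop ℕ∞) φ)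
    (hs : HasCompactSupport φ) (v : E) : Integrable (fun x => g x * fderiv ℝ φ x v) m := by
  have hc : Continuous (fderiv ℝ φ) := hφ.continuous_fderiv (by simp)
  obtain ⟨C, hC⟩ := (hs.fderiv (𝕜 := ℝ)).exists_bound_of_continuous hc
  exact hg.mul_bdd (c := C * ‖v‖) (hc.clm_apply continuous_const).aestronglyMeasurable
    (Eventually.of_forall fun x =>
      (ContinuousLinearMap.le_opNorm _ _).trans (by gcongr; exact hC x))

namespace IsUnitTestFunction

variable {E : Type*} [NormedAddCommGroup E] [NormedSpace ℝ E] {φ : E → ℝ}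

theorem zero : IsUnitTestFunction (fun _ : E => (0 : ℝ)) :=
  ⟨contDiff_const, HasCompactSupport.zero, by simp⟩

theorem neg (hφ : IsUnitTestFunction φ) : IsUnitTestFunction (fun x => -φ x) :=
  ⟨hφ.contDiff.neg, hφ.hasCompactSupport.neg, fun x => by simpa using hφ.abs_le_one x⟩

theorem comp_sub_right (hφ : IsUnitTestFunction φ) (a : E) :
    IsUnitTestFunction (fun x => φ (x - a)) :=
  ⟨hφ.contDiff.comp (contDiff_id.sub contDiff_const),
    hφ.hasCompactSupport.comp_homeomorph (Homeomorph.subRight a), fun _ => hφ.abs_le_one _⟩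

theorem differentiable (hφ : IsUnitTestFunction φ) : Differentiable ℝ φ :=
  hφ.contDiff.differentiable (by simp)

theorem continuous_fderiv (hφ : IsUnitTestFunction φ) : Continuous (fderiv ℝ φ) :=
  hφ.contDiff.continuous_fderiv (by simp)

theorem exists_norm_fderiv_le (hφ : IsUnitTestFunction φ) : ∃ C, ∀ x, ‖fderiv ℝ φ x‖ ≤ C :=
  (hφ.hasCompactSupport.fderiv (𝕜 := ℝ)).exists_bound_of_continuous hφ.continuous_fderiv

variable [MeasurableSpace E] [OpensMeasurableSpace E] {m : Measure E} {g : E → ℝ}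

theorem integrable_mul [SecondCountableTopology E] (hφ : IsUnitTestFunction φ)
    (hg : Integrable g m) : Integrable (fun x => g x * φ x) m :=
  hg.mul_bdd (c := 1) hφ.contDiff.continuous.aestronglyMeasurable
    (Eventually.of_forall fun x => by simpa using hφ.abs_le_one x)

theorem integral_mul_le [SecondCountableTopology E] (hφ : IsUnitTestFunction φ)
    (hg : Integrable g m) : ∫ x, g x * φ x ∂m ≤ ∫ x, |g x| ∂m := by
  refine integral_mono (hφ.integrable_mul hg) hg.abs fun x => ?_
  calc g x * φ x ≤ |g x * φ x| := le_abs_self _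
    _ = |g x| * |φ x| := abs_mul _ _
    _ ≤ |g x| := mul_le_of_le_one_right (abs_nonneg _) (hφ.abs_le_one x)

theorem integrable_mul_fderiv [SecondCountableTopology E] (hφ : IsUnitTestFunction φ)
    (hg : Integrable g m) (a v : E) : Integrable (fun x => g x * fderiv ℝ φ (x - a) v) m := by
  have h := (hφ.comp_sub_right a).contDiff
  simpa only [fderiv_comp_sub a] using
    hg.mul_fderiv h (hφ.comp_sub_right a).hasCompactSupport v

end IsUnitTestFunction

/-! ### L¹ duality with test functions -/

section Duality

variable {E : Type*} [NormedAddCommGroup E] [NormedSpace ℝ E] [FiniteDimensional ℝ E]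
  [MeasurableSpace E] [BorelSpace E]

/-- Measurable functions with values in `[-1, 1]` are approximated in `L¹` of a finite measure by
test functions with values in `[-1, 1]`. -/
theorem exists_isUnitTestFunction_integral_sub_le (n : Measure E) [IsFiniteMeasure n]
    {s : E → ℝ} (hs : Measurable s) (hs1 : ∀ x, |s x| ≤ 1) {ε : ℝ} (hε : 0 < ε) :
    ∃ φ : E → ℝ, IsUnitTestFunction φ ∧ ∫ x, |s x - φ x| ∂n ≤ ε := by
  obtain ⟨δ, hδ, hδε⟩ : ∃ δ : ℝ, 0 < δ ∧ δ * (1 + 2 * n.real univ) ≤ ε := by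
    have hpos : 0 < 1 + 2 * n.real univ := by positivity
    exact ⟨ε / (1 + 2 * n.real univ), by positivity, by rw [div_mul_cancel₀ _ hpos.ne']⟩
  have hsi : Integrable s n := Integrable.of_bound hs.aestronglyMeasurable 1
    (Eventually.of_forall hs1)
  obtain ⟨k, hk, hks, hkc, hki⟩ := hsi.exists_hasCompactSupport_integral_sub_le hδ
  -- Clipping to [-1, 1] only brings `k` closer to `s`. The factor (1 + δ)⁻¹ leaves exactly the room
  -- that the smoothing error (1 + δ)⁻¹ δ needs for `φ` to stay in [-1, 1].
  set c : E → ℝ := fun x => (1 + δ)⁻¹ * max (-1) (min 1 (k x)) with hc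
  have hcc : Continuous c := by fun_prop
  have hcs : Function.support c ⊆ Function.support k := by
    intro x hx hk0
    simp [hc, hk0] at hx
  obtain ⟨φ, hφ, hφc, hφs⟩ := hcc.exists_contDiff_approx (⊤ : ℕ∞)
    (ε := fun _ => (1 + δ)⁻¹ * δ) continuous_const (fun _ => by positivity)
  have hclip : ∀ x, |max (-1) (min 1 (k x))| ≤ 1 := fun x =>
    abs_le.2 ⟨le_max_left _ _, max_le (by norm_num) (min_le_left _ _)⟩
  have hdiff : ∀ x, |s x - φ x| ≤ ‖s x - k x‖ + 2 * δ := by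
    intro x
    have h1 : |φ x - c x| ≤ δ := by
      refine ((hφc x).le).trans ?_
      exact mul_le_of_le_one_left hδ.le (inv_le_one_of_one_le₀ (by linarith))
    have h2 : |c x - max (-1) (min 1 (k x))| ≤ δ := by
      have : c x - max (-1) (min 1 (k x)) = -(δ * (1 + δ)⁻¹) * max (-1) (min 1 (k x)) := by
        simp only [hc]; field_simp; ring
      rw [this, abs_mul, abs_neg, abs_of_nonneg (by positivity)]
      have h3 : δ * (1 + δ)⁻¹ ≤ δ :=
        mul_le_of_le_one_right hδ.le (inv_le_one_of_one_le₀ (by linarith))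
      calc δ * (1 + δ)⁻¹ * |max (-1) (min 1 (k x))| ≤ δ * 1 :=
            mul_le_mul h3 (hclip x) (abs_nonneg _) hδ.le
        _ = δ := mul_one _
    have h3 : |s x - max (-1) (min 1 (k x))| ≤ |s x - k x| := by
      have := abs_le.1 (hs1 x)
      rcases le_total (k x) (-1) with h | h
      · rw [min_eq_right (by linarith), max_eq_left h, abs_of_nonneg (by linarith),
          abs_of_nonneg (by linarith)]
        linarith
      · rcases le_total (k x) 1 with h' | h'
        · rw [min_eq_right h', max_eq_right h]
        · rw [min_eq_left h', max_eq_right (by norm_num), abs_of_nonpos (by linarith),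
            abs_of_nonpos (by linarith)]
          linarith
    rw [Real.norm_eq_abs]
    rw [abs_le] at h1 h2
    have := abs_le.1 h3
    rw [abs_le]
    constructor <;> linarith
  have hφt : IsUnitTestFunction φ := by
    refine ⟨hφ, hk.mono (hφs.trans hcs), fun x => ?_⟩
    have h1 : |φ x - c x| ≤ (1 + δ)⁻¹ * δ := (hφc x).le
    have h2 : |c x| ≤ (1 + δ)⁻¹ := by
      rw [hc, abs_mul, abs_of_nonneg (by positivity)]
      exact mul_le_of_le_one_right (by positivity) (hclip x)
    calc |φ x| = |(φ x - c x) + c x| := by ring_nf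
      _ ≤ |φ x - c x| + |c x| := abs_add_le _ _
      _ ≤ (1 + δ)⁻¹ * δ + (1 + δ)⁻¹ := add_le_add h1 h2
      _ = 1 := by field_simp; ring
  refine ⟨φ, hφt, ?_⟩
  have hφi : Integrable φ n := Integrable.of_bound hφ.continuous.aestronglyMeasurable 1
    (Eventually.of_forall hφt.abs_le_one)
  calc ∫ x, |s x - φ x| ∂n ≤ ∫ x, (‖s x - k x‖ + 2 * δ) ∂n :=
        integral_mono (hsi.sub hφi).abs ((hsi.sub hki).norm.add (integrable_const _)) hdiff
    _ = ∫ x, ‖s x - k x‖ ∂n + n.real univ * (2 * δ) := by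
        have hski : Integrable (fun x => ‖s x - k x‖) n := (hsi.sub hki).norm
        rw [integral_add hski (integrable_const _), integral_const, smul_eq_mul]
    _ ≤ δ * (1 + 2 * n.real univ) := by linarith
    _ ≤ ε := hδε

/-- The `L¹` norm is bounded by the supremum of the pairings with test functions. -/
theorem integral_abs_le_of_forall_isUnitTestFunction {m : Measure E} {g : E → ℝ}
    (hg : Integrable g m) {M : ℝ}
    (hM : ∀ φ : E → ℝ, IsUnitTestFunction φ → ∫ x, g x * φ x ∂m ≤ M) :
    ∫ x, |g x| ∂m ≤ M := by
  obtain ⟨g', hg'm, hgg'⟩ := hg.aestronglyMeasurable.aemeasurable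
  have hg'i : Integrable g' m := hg.congr hgg'
  have habs : ∫ x, |g x| ∂m = ∫ x, |g' x| ∂m :=
    integral_congr_ae (hgg'.mono fun x hx => by simp only [hx])
  rw [habs]
  -- `m` may be infinite, but |g'| m is finite, and the L¹(n) error in approximating the sign `s` of
  -- g' is exactly the error in the pairing with g'.
  set n := m.withDensity fun x => (‖g' x‖₊ : ℝ≥0∞) with hn
  have : IsFiniteMeasure n := isFiniteMeasure_withDensity hg'i.2.ne
  set s : E → ℝ := fun x => if 0 ≤ g' x then 1 else -1 with hs
  have hsm : Measurable s :=
    Measurable.ite (measurableSet_le measurable_const hg'm) measurable_const measurable_const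
  have hs1 : ∀ x, |s x| ≤ 1 := fun x => by
    simp only [hs]; split_ifs <;> simp
  refine le_of_forall_pos_le_add fun ε hε => ?_
  obtain ⟨φ, hφ, hφε⟩ := exists_isUnitTestFunction_integral_sub_le n hsm hs1 hε
  have hni : ∫ x, |s x - φ x| ∂n = ∫ x, |g' x| * |s x - φ x| ∂m := by
    rw [hn, integral_withDensity_eq_integral_smul hg'm.nnnorm]
    rfl
  have hint : Integrable (fun x => |g' x| * |s x - φ x|) m := by
    refine hg'i.abs.mul_bdd (c := 2)
      (hsm.sub hφ.contDiff.continuous.measurable).abs.aestronglyMeasurable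
      (Eventually.of_forall fun x => ?_)
    have := abs_le.1 (hs1 x)
    have := abs_le.1 (hφ.abs_le_one x)
    rw [Real.norm_eq_abs, abs_abs, abs_le]
    constructor <;> linarith
  calc ∫ x, |g' x| ∂m ≤ ∫ x, (g' x * φ x + |g' x| * |s x - φ x|) ∂m := by
        refine integral_mono hg'i.abs ((hφ.integrable_mul hg'i).add hint) fun x => ?_
        have h1 : |g' x| = g' x * s x := by
          simp only [hs]; split_ifs with h
          · rw [abs_of_nonneg h, mul_one]
          · rw [abs_of_neg (not_le.1 h)]; ring
        have h2 : g' x * (s x - φ x) ≤ |g' x| * |s x - φ x| := by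
          rw [← abs_mul]; exact le_abs_self _
        simp only
        linarith
    _ = ∫ x, g x * φ x ∂m + ∫ x, |s x - φ x| ∂n := by
        rw [integral_add (hφ.integrable_mul hg'i) hint, hni]
        congr 1
        exact integral_congr_ae (hgg'.mono fun x hx => by simp only [hx])
    _ ≤ M + ε := add_le_add (hM φ hφ) hφε

end Duality

noncomputable section

/-! ### Directional variation and translation increments -/

section DirVariation

variable {E : Type*} [NormedAddCommGroup E] [NormedSpace ℝ E] [MeasurableSpace E]

/-- The variation of `f` in the direction `v`: the supremum of `∫ f ∂_v φ` over smooth compactly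
supported `φ` with `|φ| ≤ 1`. -/
def dirVariation (μ : Measure E) (f : E → ℝ) (v : E) : ℝ :=
  ⨆ φ : {φ : E → ℝ // IsUnitTestFunction φ}, ∫ y, f y * fderiv ℝ φ.1 y v ∂μ

/-- The directional variations of `f` are bounded by `M` times the length of the direction. -/
def HasDirVariationBound (μ : Measure E) (f : E → ℝ) (M : ℝ) : Prop :=
  ∀ φ : E → ℝ, IsUnitTestFunction φ → ∀ v, ∫ y, f y * fderiv ℝ φ y v ∂μ ≤ M * ‖v‖

/-- The `L¹` norm of the increment `f (· + v) - f`. -/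
def translationIncrement (μ : Measure E) (f : E → ℝ) (v : E) : ℝ :=
  ∫ y, |f (y + v) - f y| ∂μ

theorem fderiv_comp_sub_const {E : Type*} [NormedAddCommGroup E] [NormedSpace ℝ E]
    (φ : E → ℝ) (a y : E) :
    fderiv ℝ (fun x => φ (x - a)) y = fderiv ℝ φ (y - a) :=
  fderiv_comp_sub a

section Translation

variable {E : Type*} [NormedAddCommGroup E] [MeasurableSpace E] [BorelSpace E]
  {μ : Measure E} [μ.IsAddRightInvariant] {f : E → ℝ}

theorem MeasureTheory.Integrable.translate_sub (hf : Integrable f μ) (v : E) :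
    Integrable (fun y => f (y + v) - f y) μ :=
  (hf.comp_add_right v).sub hf

theorem translationIncrement_le (hf : Integrable f μ) (v : E) :
    translationIncrement μ f v ≤ 2 * ∫ y, |f y| ∂μ := by
  have h1 : ∫ y, |f (y + v)| ∂μ = ∫ y, |f y| ∂μ :=
    integral_add_right_eq_self (μ := μ) (fun y => |f y|) v
  calc translationIncrement μ f v ≤ ∫ y, (|f (y + v)| + |f y|) ∂μ :=
        integral_mono (hf.translate_sub v).abs ((hf.comp_add_right v).abs.add hf.abs)
          fun y => abs_sub _ _
    _ = 2 * ∫ y, |f y| ∂μ := by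
        rw [integral_add (hf.comp_add_right v).abs hf.abs, h1]; ring

/-- Insert the intermediate translate f(· + w) and use translation invariance. -/
theorem translationIncrement_sub_le (hf : Integrable f μ) (v w : E) :
    translationIncrement μ f v ≤ translationIncrement μ f w + translationIncrement μ f (v - w) := by
  have h1 : ∫ y, |f (y + v) - f (y + w)| ∂μ = translationIncrement μ f (v - w) := by
    have := integral_add_right_eq_self (μ := μ) (fun y => |f (y + (v - w)) - f y|) w
    rw [translationIncrement, ← this]
    congr 1 with y
    rw [show y + w + (v - w) = y + v by abel]
  have h2 : Integrable (fun y => f (y + v) - f (y + w)) μ :=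
    (hf.comp_add_right v).sub (hf.comp_add_right w)
  rw [← h1, translationIncrement, translationIncrement,
    ← integral_add (hf.translate_sub w).abs h2.abs]
  refine integral_mono (hf.translate_sub v).abs ((hf.translate_sub w).abs.add h2.abs) fun y => ?_
  have := abs_add_le (f (y + w) - f y) (f (y + v) - f (y + w))
  simpa using this

end Translation

namespace HasDirVariationBound

variable {μ : Measure E} {f : E → ℝ} {M : ℝ}

theorem bddAbove (h : HasDirVariationBound μ f M) (v : E) :
    BddAbove (range fun φ : {φ : E → ℝ // IsUnitTestFunction φ} =>
      ∫ y, f y * fderiv ℝ φ.1 y v ∂μ) :=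
  ⟨M * ‖v‖, by rintro _ ⟨φ, rfl⟩; exact h φ.1 φ.2 v⟩

theorem integral_le_dirVariation (h : HasDirVariationBound μ f M) {φ : E → ℝ}
    (hφ : IsUnitTestFunction φ) (v : E) :
    ∫ y, f y * fderiv ℝ φ y v ∂μ ≤ dirVariation μ f v :=
  le_ciSup (h.bddAbove v) ⟨φ, hφ⟩

theorem dirVariation_le {v : E} {C : ℝ}
    (h : ∀ φ : E → ℝ, IsUnitTestFunction φ → ∫ y, f y * fderiv ℝ φ y v ∂μ ≤ C) :
    dirVariation μ f v ≤ C := by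
  have : Nonempty {φ : E → ℝ // IsUnitTestFunction φ} := ⟨⟨_, IsUnitTestFunction.zero⟩⟩
  exact ciSup_le fun φ => h φ.1 φ.2

theorem dirVariation_le_mul_norm (h : HasDirVariationBound μ f M) (v : E) :
    dirVariation μ f v ≤ M * ‖v‖ :=
  dirVariation_le fun φ hφ => h φ hφ v

theorem abs_integral_le_dirVariation (h : HasDirVariationBound μ f M) {φ : E → ℝ}
    (hφ : IsUnitTestFunction φ) (v : E) :
    |∫ y, f y * fderiv ℝ φ y v ∂μ| ≤ dirVariation μ f v := by
  refine abs_le'.2 ⟨h.integral_le_dirVariation hφ v, ?_⟩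
  have := h.integral_le_dirVariation hφ.neg v
  simpa only [fderiv_fun_neg, neg_apply, mul_neg, integral_neg] using this

theorem dirVariation_smul_le (h : HasDirVariationBound μ f M) {c : ℝ} (hc : 0 ≤ c) (v : E) :
    dirVariation μ f (c • v) ≤ c * dirVariation μ f v := by
  refine dirVariation_le fun φ hφ => ?_
  have : ∫ y, f y * fderiv ℝ φ y (c • v) ∂μ = c * ∫ y, f y * fderiv ℝ φ y v ∂μ := by
    rw [← integral_const_mul]
    congr 1 with y
    rw [map_smul, smul_eq_mul]; ring
  rw [this]
  exact mul_le_mul_of_nonneg_left (h.integral_le_dirVariation hφ v) hc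

/-- The inequality for `c` and the one for `c⁻¹` give equality. -/
theorem dirVariation_smul (h : HasDirVariationBound μ f M) {c : ℝ} (hc : 0 < c) (v : E) :
    dirVariation μ f (c • v) = c * dirVariation μ f v := by
  refine le_antisymm (h.dirVariation_smul_le hc.le v) ?_
  have := h.dirVariation_smul_le (inv_nonneg.2 hc.le) (c • v)
  rw [inv_smul_smul₀ hc.ne'] at this
  calc c * dirVariation μ f v ≤ c * (c⁻¹ * dirVariation μ f (c • v)) := by gcongr
    _ = _ := by field_simp

variable [BorelSpace E] [SecondCountableTopology E]

theorem dirVariation_add_le (h : HasDirVariationBound μ f M) (hf : Integrable f μ) (v w : E) :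
    dirVariation μ f (v + w) ≤ dirVariation μ f v + dirVariation μ f w := by
  refine dirVariation_le fun φ hφ => ?_
  have h1 := hφ.integrable_mul_fderiv hf 0 v
  have h2 := hφ.integrable_mul_fderiv hf 0 w
  simp only [sub_zero] at h1 h2
  simp only [map_add, mul_add]
  rw [integral_add h1 h2]
  exact add_le_add (h.integral_le_dirVariation hφ v) (h.integral_le_dirVariation hφ w)

theorem dirVariation_le_add_mul_norm_sub (h : HasDirVariationBound μ f M) (hf : Integrable f μ)
    (v w : E) : dirVariation μ f v ≤ dirVariation μ f w + M * ‖v - w‖ := by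
  have := h.dirVariation_add_le hf w (v - w)
  rw [add_sub_cancel] at this
  linarith [h.dirVariation_le_mul_norm (v - w)]

theorem continuous_dirVariation (h : HasDirVariationBound μ f M) (hf : Integrable f μ) :
    Continuous (dirVariation μ f) := by
  have : LipschitzWith M.toNNReal (dirVariation μ f) := by
    refine LipschitzWith.of_le_add_mul _ fun v w => ?_
    refine (h.dirVariation_le_add_mul_norm_sub hf v w).trans ?_
    rw [dist_eq_norm]
    gcongr
    exact Real.le_coe_toNNReal M
  exact this.continuous

/-- The derivative of `s ↦ ∫ f(y) φ(y - s v) dy`. -/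
theorem _root_.IsUnitTestFunction.hasDerivAt_integral_mul_translate {φ : E → ℝ}
    (hφ : IsUnitTestFunction φ) (hf : Integrable f μ) (v : E) (s : ℝ) :
    HasDerivAt (fun s : ℝ => ∫ y, f y * φ (y - s • v) ∂μ)
      (-∫ y, f y * fderiv ℝ φ (y - s • v) v ∂μ) s := by
  obtain ⟨C, hC⟩ := hφ.exists_norm_fderiv_le
  rw [← integral_neg]
  refine (hasDerivAt_integral_of_dominated_loc_of_deriv_le (F := fun s y => f y * φ (y - s • v))
    (F' := fun s y => -(f y * fderiv ℝ φ (y - s • v) v)) (bound := fun y => |f y| * (C * ‖v‖))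
    (Metric.ball_mem_nhds s one_pos) (Eventually.of_forall fun t => ?_) ?_ ?_ ?_ ?_ ?_).2
  · exact ((hφ.comp_sub_right (t • v)).integrable_mul hf).aestronglyMeasurable
  · exact (hφ.comp_sub_right (s • v)).integrable_mul hf
  · exact (hφ.integrable_mul_fderiv hf (s • v) v).neg.aestronglyMeasurable
  · refine Eventually.of_forall fun y t _ => ?_
    rw [norm_neg, norm_mul, Real.norm_eq_abs (f y)]
    gcongr
    exact (ContinuousLinearMap.le_opNorm _ _).trans (by gcongr; exact hC _)
  · exact hf.abs.mul_const _
  · refine Eventually.of_forall fun y t _ => ?_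
    have h1 : HasDerivAt (fun t : ℝ => y - t • v) (-v) t := by
      simpa using ((hasDerivAt_id t).smul_const v).const_sub y
    have h2 := ((hφ.differentiable (y - t • v)).hasFDerivAt.comp_hasDerivAt t h1).const_mul (f y)
    simpa using h2

/-- The mean value inequality for translates of test functions. -/
theorem integral_mul_translate_sub_le (h : HasDirVariationBound μ f M) (hf : Integrable f μ)
    {φ : E → ℝ} (hφ : IsUnitTestFunction φ) (v : E) :
    ∫ y, f y * φ (y - v) ∂μ - ∫ y, f y * φ y ∂μ ≤ dirVariation μ f v := by
  -- Translates of test functions are test functions, so the derivative along the segment is bounded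
  -- by the directional variation throughout.
  have key := norm_image_sub_le_of_norm_deriv_le_segment_01'
    (f := fun s : ℝ => ∫ y, f y * φ (y - s • v) ∂μ) (C := dirVariation μ f v)
    (fun s _ => (hφ.hasDerivAt_integral_mul_translate hf v s).hasDerivWithinAt) fun s _ => ?_
  · simp only [one_smul, zero_smul, sub_zero] at key
    exact (le_abs_self _).trans key
  · rw [norm_neg, Real.norm_eq_abs]
    have := h.abs_integral_le_dirVariation (hφ.comp_sub_right (s • v)) v
    simpa only [fderiv_comp_sub_const] using this

variable [μ.IsAddRightInvariant]

/-- A change of variables moves the increment from `f` to the smooth factor. -/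
theorem _root_.integral_translate_sub_mul {φ : E → ℝ} (hφ : IsUnitTestFunction φ)
    (hf : Integrable f μ) (v : E) :
    ∫ y, (f (y + v) - f y) * φ y ∂μ = ∫ y, f y * φ (y - v) ∂μ - ∫ y, f y * φ y ∂μ := by
  simp only [sub_mul]
  rw [integral_sub (hφ.integrable_mul (hf.comp_add_right v)) (hφ.integrable_mul hf)]
  congr 1
  simpa using integral_add_right_eq_self (μ := μ) (fun y => f y * φ (y - v)) v

/-- One test function attaining the supremum up to η / 2 suffices: the difference quotient of its
pairing tends to the derivative, and the increment dominates the pairing. The range of `t` depends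
on `v`; uniformity comes later. -/
theorem _root_.eventually_mul_dirVariation_le (hf : Integrable f μ)
    (v : E) {η : ℝ} (hη : 0 < η) :
    ∀ᶠ t : ℝ in 𝓝[>] 0, t * dirVariation μ f v ≤ translationIncrement μ f (t • v) + t * η := by
  have hη2 : 0 < η / 2 := by positivity
  obtain ⟨φ, hφ, hφV⟩ : ∃ φ : E → ℝ, IsUnitTestFunction φ ∧
      dirVariation μ f v - η / 2 < ∫ y, f y * fderiv ℝ φ y v ∂μ := by
    by_contra! hcon
    linarith [dirVariation_le hcon]
  have hd := hφ.neg.hasDerivAt_integral_mul_translate hf v 0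
  have hd' := hd.tendsto_slope_zero_right
  simp only [zero_add, zero_smul, sub_zero, fderiv_fun_neg, neg_apply, mul_neg,
    integral_neg, neg_neg] at hd'
  have hlt : dirVariation μ f v - η < ∫ y, f y * fderiv ℝ φ y v ∂μ := by linarith
  filter_upwards [hd'.eventually (lt_mem_nhds hlt), self_mem_nhdsWithin] with t ht ht0
  have ht0 : 0 < t := ht0
  have h1 : ∫ y, (f (y + t • v) - f y) * -φ y ∂μ ≤ translationIncrement μ f (t • v) :=
    hφ.neg.integral_mul_le (hf.translate_sub (t • v))
  rw [integral_translate_sub_mul hφ.neg hf] at h1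
  simp only [mul_neg, integral_neg] at h1
  rw [smul_eq_mul, inv_mul_eq_div, lt_div_iff₀ ht0] at ht
  linarith

variable [FiniteDimensional ℝ E]

/-- Duality reduces the L¹ norm to pairings with test functions, which the mean value inequality
bounds. -/
theorem translationIncrement_le_dirVariation (h : HasDirVariationBound μ f M)
    (hf : Integrable f μ) (v : E) : translationIncrement μ f v ≤ dirVariation μ f v :=
  integral_abs_le_of_forall_isUnitTestFunction (hf.translate_sub v) fun φ hφ => by
    rw [integral_translate_sub_mul hφ hf]
    exact h.integral_mul_translate_sub_le hf hφ v

theorem translationIncrement_le_add_mul_norm_sub (h : HasDirVariationBound μ f M)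
    (hf : Integrable f μ) (v w : E) :
    translationIncrement μ f v ≤ translationIncrement μ f w + M * ‖v - w‖ := by
  linarith [translationIncrement_sub_le hf v w, h.translationIncrement_le_dirVariation hf (v - w),
    h.dirVariation_le_mul_norm (v - w)]

theorem continuous_translationIncrement (h : HasDirVariationBound μ f M) (hf : Integrable f μ) :
    Continuous (translationIncrement μ f) := by
  have : LipschitzWith M.toNNReal (translationIncrement μ f) := by
    refine LipschitzWith.of_le_add_mul _ fun v w => ?_
    refine (h.translationIncrement_le_add_mul_norm_sub hf v w).trans ?_
    rw [dist_eq_norm]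
    gcongr
    exact Real.le_coe_toNNReal M
  exact this.continuous

/-- The increments of `f` are approximated by the directional variations to first order, uniformly
in the direction. -/
theorem exists_dirVariation_le (h : HasDirVariationBound μ f M) (hf : Integrable f μ)
    {η : ℝ} (hη : 0 < η) :
    ∃ δ > 0, ∀ v : E, ‖v‖ ≤ δ →
      dirVariation μ f v ≤ translationIncrement μ f v + η * ‖v‖ := by
  have key : ∀ᶠ t : ℝ in 𝓝 0, ∀ v ∈ Metric.sphere (0 : E) 1,
      0 < t → t * dirVariation μ f v ≤ translationIncrement μ f (t • v) + t * η := by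
    refine (isCompact_sphere (0 : E) 1).eventually_forall_of_forall_eventually fun v _ => ?_
    have hη2 : 0 < η / 2 := by positivity
    have h1 := eventually_mul_dirVariation_le hf v hη2
    rw [eventually_nhdsWithin_iff] at h1
    -- Passing from direction `v` to `w` costs t M ‖w - v‖ once for the variation and once for the
    -- increment; hence the factor 2.
    have h2 : ∀ᶠ w in 𝓝 v, 2 * (M * ‖w - v‖) < η / 2 := by
      have hc : ContinuousAt (fun w => 2 * (M * ‖w - v‖)) v := by fun_prop
      exact hc.eventually (gt_mem_nhds (by simpa using hη2))
    filter_upwards [h1.prod_nhds h2] with p hp hp0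
    obtain ⟨t, w⟩ := p
    simp only at hp hp0 ⊢
    have h3 := hp.1 hp0
    have h4 := h.dirVariation_le_add_mul_norm_sub hf w v
    have h5 := h.translationIncrement_le_add_mul_norm_sub hf (t • v) (t • w)
    rw [← smul_sub, norm_smul, Real.norm_of_nonneg hp0.le, norm_sub_rev] at h5
    nlinarith [mul_le_mul_of_nonneg_left h4 hp0.le, mul_lt_mul_of_pos_left hp.2 hp0]
  obtain ⟨δ, hδ, hball⟩ := Metric.eventually_nhds_iff.1 key
  refine ⟨δ / 2, by positivity, fun v hv => ?_⟩
  rcases eq_or_ne v 0 with rfl | hv0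
  · have h0 := h.dirVariation_le_mul_norm 0
    have : 0 ≤ translationIncrement μ f 0 := integral_nonneg fun _ => abs_nonneg _
    simp only [norm_zero, mul_zero] at h0 ⊢
    linarith
  · have hn : 0 < ‖v‖ := norm_pos_iff.2 hv0
    have h1 := hball (y := ‖v‖) (by rw [Real.dist_eq, sub_zero, abs_norm]; linarith)
      (‖v‖⁻¹ • v) (by simp [norm_smul, hn.ne']) hn
    rw [← h.dirVariation_smul hn, smul_inv_smul₀ hn.ne'] at h1
    linarith

end HasDirVariationBound

end DirVariation

/-! ### Vague compactness -/

/-- Measures of uniformly bounded mass on a locally compact space converge vaguely, along an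
ultrafilter, to a finite measure. -/
theorem exists_tendsto_integral_of_measure_univ_le {X ι : Type*} [TopologicalSpace X] [T2Space X]
    [LocallyCompactSpace X] [MeasurableSpace X] [BorelSpace X] (U : Ultrafilter ι)
    (m : ι → Measure X) {K : ℝ≥0∞} (hK : K ≠ ∞) (hm : ∀ i, m i univ ≤ K) :
    ∃ m₀ : Measure X, IsFiniteMeasure m₀ ∧
      ∀ φ : C_c(X, ℝ), Tendsto (fun i => ∫ x, φ x ∂m i) U (𝓝 (∫ x, φ x ∂m₀)) := by
  have hfin : ∀ i, IsFiniteMeasure (m i) := fun i => ⟨(hm i).trans_lt hK.lt_top⟩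
  have hreal : ∀ i, (m i).real univ ≤ K.toReal := fun i => ENNReal.toReal_mono hK (hm i)
  have hint : ∀ (φ : C_c(X, ℝ)) i, Integrable φ (m i) := fun φ i =>
    φ.continuous.integrable_of_hasCompactSupport φ.hasCompactSupport
  have hbd : ∀ (φ : C_c(X, ℝ)) (B : ℝ), (∀ x, ‖φ x‖ ≤ B) → ∀ i,
      ‖∫ x, φ x ∂m i‖ ≤ B * (m i).real univ := fun φ B hB i =>
    norm_integral_le_of_norm_le_const (Eventually.of_forall hB)
  -- A bounded family of reals converges along an ultrafilter, so the limits exist for all `φ` at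
  -- once without extracting subsequences. They form a positive functional, to which Riesz–Markov
  -- applies.
  have hex : ∀ φ : C_c(X, ℝ), ∃ L, Tendsto (fun i => ∫ x, φ x ∂m i) U (𝓝 L) := by
    intro φ
    obtain ⟨B, hB⟩ := φ.hasCompactSupport.exists_bound_of_continuous φ.continuous
    have hmem : ∀ i, ∫ x, φ x ∂m i ∈ Metric.closedBall (0 : ℝ) (|B| * K.toReal) := by
      intro i
      rw [mem_closedBall_zero_iff]
      refine (hbd φ |B| (fun x => (hB x).trans (le_abs_self B)) i).trans ?_
      gcongr
      exact hreal i
    obtain ⟨L, -, hL⟩ := (isCompact_closedBall (0 : ℝ) (|B| * K.toReal)).ultrafilter_le_nhds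
      (U.map fun i => ∫ x, φ x ∂m i) (by
        rw [le_principal_iff]
        exact Filter.mem_map.2 (univ_mem' hmem))
    exact ⟨L, hL⟩
  choose Λ hΛ using hex
  let Λₗ : C_c(X, ℝ) →ₗ[ℝ] ℝ :=
    { toFun := Λ
      map_add' := fun φ ψ => by
        refine tendsto_nhds_unique (hΛ (φ + ψ)) (((hΛ φ).add (hΛ ψ)).congr fun i => ?_)
        exact (integral_add (hint φ i) (hint ψ i)).symm
      map_smul' := fun c φ => by
        refine tendsto_nhds_unique (hΛ (c • φ)) (((hΛ φ).const_mul c).congr fun i => ?_)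
        exact (integral_const_mul c _).symm }
  let Λₚ : C_c(X, ℝ) →ₚ[ℝ] ℝ := PositiveLinearMap.mk₀ Λₗ fun φ hφ =>
    ge_of_tendsto' (hΛ φ) fun i => integral_nonneg hφ
  refine ⟨RealRMK.rieszMeasure Λₚ, ⟨?_⟩, fun φ => ?_⟩
  · refine lt_of_le_of_lt ?_ hK.lt_top
    -- By inner regularity it is enough to bound the mass of compact sets, using a cutoff equal to 1
    -- on the set.
    rw [isOpen_univ.measure_eq_iSup_isCompact]
    refine iSup₂_le fun C _ => iSup_le fun hC => ?_
    obtain ⟨φ, hφ1, -, hφs, hφr⟩ := exists_continuous_one_zero_of_isCompact hC isClosed_empty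
      (disjoint_empty C)
    let ψ : C_c(X, ℝ) := ⟨φ, hφs⟩
    refine (RealRMK.rieszMeasure_le_of_eq_one Λₚ (f := ψ) (fun x => (hφr x).1) hC
      (fun x hx => hφ1 hx)).trans ?_
    refine ENNReal.ofReal_le_of_le_toReal (le_of_tendsto' (hΛ ψ) fun i => ?_)
    refine (le_abs_self _).trans ((hbd ψ 1 (fun x => ?_) i).trans ?_)
    · exact abs_le.2 ⟨neg_one_lt_zero.le.trans (hφr x).1, (hφr x).2⟩
    · rw [one_mul]; exact hreal i
  · rw [RealRMK.integral_rieszMeasure]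
    exact hΛ φ

/-! ### Vector measures with a density -/

section WithDensity

variable {X F : Type*} [MeasurableSpace X] [NormedAddCommGroup F] [NormedSpace ℝ F]
  [CompleteSpace F] {m : Measure X} {h : X → F}

theorem integrable_variation_withDensityᵥ_iff (hh : Integrable h m) {φ : X → ℝ} :
    Integrable φ (m.withDensityᵥ h).variation ↔ Integrable (fun x => ‖h x‖ * φ x) m := by
  rw [Measure.variation_withDensityᵥ hh,
    integrable_withDensity_iff_integrable_smul₀' hh.aestronglyMeasurable.enorm
      (Eventually.of_forall fun _ => enorm_lt_top)]
  simp

theorem integrable_smul_of_integrable_variation_withDensityᵥ (hh : Integrable h m) {φ : X → ℝ}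
    (hφ : Integrable φ (m.withDensityᵥ h).variation) : Integrable (fun x => φ x • h x) m := by
  rw [integrable_variation_withDensityᵥ_iff hh] at hφ
  -- `φ` need not be a.e. measurable for `m` where h = 0; this factorization gives measurability of
  -- the product.
  have heq : (fun x => φ x • h x) = fun x => (‖h x‖ * φ x) • (‖h x‖⁻¹ • h x) := by
    ext x
    rcases eq_or_ne (h x) 0 with h0 | h0
    · simp [h0]
    · rw [smul_smul]
      congr 1
      have := norm_ne_zero_iff.2 h0
      field_simp
  refine hφ.mono ?_ (Eventually.of_forall fun x => ?_)
  · rw [heq]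
    exact hφ.aestronglyMeasurable.smul
      (hh.aestronglyMeasurable.norm.aemeasurable.inv.aestronglyMeasurable.smul
        hh.aestronglyMeasurable)
  · rw [norm_smul, norm_mul, norm_norm, mul_comm]

/-- This isometry makes φ ↦ ∫ φ h dm continuous on L¹ of the variation, and insensitive to null
sets, as the induction in `integral_withDensityᵥ` requires. -/
theorem integral_norm_smul_eq (hh : Integrable h m) (φ : X → ℝ) :
    ∫ x, ‖φ x • h x‖ ∂m = ∫ x, ‖φ x‖ ∂(m.withDensityᵥ h).variation := by
  rw [Measure.variation_withDensityᵥ hh]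
  have := integral_withDensity_eq_integral_smul₀ (μ := m) (f := fun x => ‖h x‖₊)
    hh.aestronglyMeasurable.nnnorm.aemeasurable (fun x => ‖φ x‖)
  refine Eq.trans ?_ this.symm
  congr 1 with x
  rw [norm_smul, mul_comm]
  rfl

/-- Integration against a vector measure given by a density. -/
theorem integral_withDensityᵥ (hh : Integrable h m) {φ : X → ℝ}
    (hφ : Integrable φ (m.withDensityᵥ h).variation) :
    ∫ᵛ x, φ x ∂•(m.withDensityᵥ h) = ∫ x, φ x • h x ∂m := by
  have hfin : IsFiniteMeasure (m.withDensityᵥ h).variation := by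
    rw [Measure.variation_withDensityᵥ hh]
    exact isFiniteMeasure_withDensity hh.2.ne
  have hsm := fun {ψ : X → ℝ} (hψ : Integrable ψ (m.withDensityᵥ h).variation) =>
    integrable_smul_of_integrable_variation_withDensityᵥ hh hψ
  refine Integrable.induction (fun φ : X → ℝ =>
    ∫ᵛ x, φ x ∂•(m.withDensityᵥ h) = ∫ x, φ x • h x ∂m) ?_ ?_ ?_ ?_ hφ
  · intro c s hs _
    rw [VectorMeasure.integral_indicator_const c hs, withDensityᵥ_apply hh hs]
    have heq : (fun x => s.indicator (fun _ => c) x • h x) = s.indicator fun x => c • h x := by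
      ext x
      by_cases hx : x ∈ s <;> simp [hx]
    rw [heq, integral_indicator hs, integral_smul, ContinuousLinearMap.lsmul_apply]
  · intro φ ψ _ hφ hψ h1 h2
    simp only [Pi.add_apply, add_smul]
    rw [VectorMeasure.integral_fun_add hφ hψ, h1, h2, integral_add (hsm hφ) (hsm hψ)]
  · refine isClosed_eq VectorMeasure.continuous_integral ?_
    refine LipschitzWith.continuous (K := 1) (LipschitzWith.of_dist_le_mul fun φ ψ => ?_)
    rw [NNReal.coe_one, one_mul, L1.dist_eq_integral_dist, dist_eq_norm,
      ← integral_sub (hsm (L1.integrable_coeFn φ)) (hsm (L1.integrable_coeFn ψ))]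
    refine (norm_integral_le_integral_norm _).trans_eq ?_
    simp only [← sub_smul, dist_eq_norm]
    exact integral_norm_smul_eq hh (fun x => φ x - ψ x)
  · intro φ ψ hφψ hφ h1
    rw [← VectorMeasure.integral_congr_ae hφψ, h1]
    have hψ := hφ.congr hφψ
    rw [← sub_eq_zero, ← integral_sub (hsm hφ) (hsm hψ), ← norm_le_zero_iff]
    refine (norm_integral_le_integral_norm _).trans_eq ?_
    simp only [← sub_smul]
    rw [integral_norm_smul_eq hh (fun x => φ x - ψ x)]
    refine integral_eq_zero_of_ae (hφψ.mono fun x hx => ?_)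
    simp [hx]

end WithDensity

/-! ### Directional derivatives as measures -/

theorem integral_withDensity_ofReal {X : Type*} [MeasurableSpace X] {μ : Measure X} {g : X → ℝ}
    (hg : AEMeasurable g μ) (φ : X → ℝ) :
    ∫ x, φ x ∂μ.withDensity (fun x => ENNReal.ofReal (g x)) = ∫ x, max (g x) 0 * φ x ∂μ := by
  rw [integral_withDensity_eq_integral_toReal_smul₀ hg.ennreal_ofReal
    (Eventually.of_forall fun _ => ENNReal.ofReal_lt_top)]
  rfl

theorem withDensity_ofReal_univ_le {X : Type*} [MeasurableSpace X] {μ : Measure X} {g : X → ℝ}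
    (hg : Integrable g μ) {C : ℝ} (hC : ∫ x, |g x| ∂μ ≤ C) :
    μ.withDensity (fun x => ENNReal.ofReal (g x)) univ ≤ ENNReal.ofReal C := by
  rw [withDensity_apply _ MeasurableSet.univ, Measure.restrict_univ]
  calc ∫⁻ x, ENNReal.ofReal (g x) ∂μ ≤ ∫⁻ x, ENNReal.ofReal |g x| ∂μ :=
        lintegral_mono fun x => ENNReal.ofReal_le_ofReal (le_abs_self _)
    _ = ENNReal.ofReal (∫ x, |g x| ∂μ) :=
        (ofReal_integral_eq_lintegral_ofReal hg.abs
          (Eventually.of_forall fun _ => abs_nonneg _)).symm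
    _ ≤ ENNReal.ofReal C := ENNReal.ofReal_le_ofReal hC

theorem exists_pos_isUnitTestFunction_mul {E : Type*} [NormedAddCommGroup E] [NormedSpace ℝ E]
    {φ : E → ℝ} (hφ : ContDiff ℝ ((⊤ : ℕ∞) : WithTop ℕ∞) φ)
    (hs : HasCompactSupport φ) : ∃ c : ℝ, 0 < c ∧ IsUnitTestFunction fun x => c * φ x := by
  obtain ⟨B, hB⟩ := hs.exists_bound_of_continuous hφ.continuous
  have hpos : 0 < 1 + |B| := by positivity
  refine ⟨(1 + |B|)⁻¹, by positivity, contDiff_const.mul hφ, hs.mul_left, fun x => ?_⟩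
  rw [abs_mul, abs_of_pos (by positivity), inv_mul_le_iff₀ hpos, mul_one]
  have := hB x
  rw [Real.norm_eq_abs] at this
  linarith [le_abs_self B]

section

variable {E : Type*} [NormedAddCommGroup E] [NormedSpace ℝ E]
  [MeasurableSpace E] {μ : Measure E} {f : E → ℝ} {M : ℝ}

variable [FiniteDimensional ℝ E] [BorelSpace E]

/-- The distributional derivative of a function of bounded variation in a given direction is a
difference of two finite measures. -/
theorem HasDirVariationBound.exists_measure_sub [μ.IsAddRightInvariant]
    (h : HasDirVariationBound μ f M) (hf : Integrable f μ) (v : E) :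
    ∃ m₁ m₂ : Measure E, IsFiniteMeasure m₁ ∧ IsFiniteMeasure m₂ ∧
      ∀ φ : E → ℝ, ContDiff ℝ ((⊤ : ℕ∞) : WithTop ℕ∞) φ → HasCompactSupport φ →
        ∫ y, f y * fderiv ℝ φ y v ∂μ = ∫ x, φ x ∂m₁ - ∫ x, φ x ∂m₂ := by
  set t : ℕ → ℝ := fun n => ((n : ℝ) + 1)⁻¹ with ht
  have ht0 : ∀ n, 0 < t n := fun n => by positivity
  set g : ℕ → E → ℝ := fun n y => (t n)⁻¹ * (f (y + t n • v) - f y) with hg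
  have hgi : ∀ n, Integrable (g n) μ := fun n => (hf.translate_sub _).const_mul _
  have hgV : ∀ n, ∫ y, |g n y| ∂μ ≤ dirVariation μ f v := by
    intro n
    have h1 := h.translationIncrement_le_dirVariation hf (t n • v)
    rw [h.dirVariation_smul (ht0 n)] at h1
    simp only [hg, abs_mul]
    rw [integral_const_mul, abs_of_pos (inv_pos.2 (ht0 n)), inv_mul_le_iff₀ (ht0 n)]
    exact h1
  have hgV' : ∀ n, ∫ y, |-g n y| ∂μ ≤ dirVariation μ f v := fun n => by
    simpa only [abs_neg] using hgV n
  -- The positive and negative parts of the difference quotients have mass at most V(v). Both limits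
  -- are taken along the same ultrafilter, which refines `atTop`, so the limit of the pairings is
  -- the known derivative.
  obtain ⟨m₁, hm₁, hl₁⟩ := exists_tendsto_integral_of_measure_univ_le (hyperfilter ℕ)
    (fun n => μ.withDensity fun y => ENNReal.ofReal (g n y)) ENNReal.ofReal_ne_top
    fun n => withDensity_ofReal_univ_le (hgi n) (hgV n)
  obtain ⟨m₂, hm₂, hl₂⟩ := exists_tendsto_integral_of_measure_univ_le (hyperfilter ℕ)
    (fun n => μ.withDensity fun y => ENNReal.ofReal (-g n y)) ENNReal.ofReal_ne_top
    fun n => withDensity_ofReal_univ_le (hgi n).neg (hgV' n)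
  -- The measures appear in swapped order because integration by parts changes the sign.
  have key : ∀ φ : E → ℝ, IsUnitTestFunction φ →
      ∫ y, f y * fderiv ℝ φ y v ∂μ = ∫ x, φ x ∂m₂ - ∫ x, φ x ∂m₁ := by
    intro φ hφ
    let ψ : C_c(E, ℝ) := ⟨⟨φ, hφ.contDiff.continuous⟩, hφ.hasCompactSupport⟩
    have hlim := (hl₂ ψ).sub (hl₁ ψ)
    refine tendsto_nhds_unique (Tendsto.mono_left ?_ (Nat.hyperfilter_le_atTop)) hlim
    have hd := (hφ.hasDerivAt_integral_mul_translate hf v 0).tendsto_slope_zero_right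
    have htt : Tendsto t atTop (𝓝[>] 0) := by
      refine tendsto_nhdsWithin_iff.2 ⟨?_, Eventually.of_forall ht0⟩
      simpa only [ht, one_div] using tendsto_one_div_add_atTop_nhds_zero_nat (𝕜 := ℝ)
    have hd' := (hd.comp htt).neg
    simp only [zero_smul, sub_zero, neg_neg] at hd'
    refine hd'.congr fun n => ?_
    have hmul : ∀ {k : E → ℝ}, Integrable k μ → Integrable (fun x => max (k x) 0 * φ x) μ :=
      fun hk => hφ.integrable_mul hk.pos_part
    rw [integral_withDensity_ofReal (hgi n).aestronglyMeasurable.aemeasurable,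
      integral_withDensity_ofReal (g := fun y => -g n y)
        (hgi n).neg.aestronglyMeasurable.aemeasurable]
    change _ = ∫ x, max (-g n x) 0 * φ x ∂μ - ∫ x, max (g n x) 0 * φ x ∂μ
    rw [← integral_sub (hmul (k := fun y => -g n y) (hgi n).neg) (hmul (hgi n))]
    have h2 : ∀ x, max (-g n x) 0 * φ x - max (g n x) 0 * φ x
        = -((t n)⁻¹ * ((f (x + t n • v) - f x) * φ x)) := by
      intro x
      have := max_zero_sub_max_neg_zero_eq_self (g n x)
      calc _ = -(max (g n x) 0 - max (-g n x) 0) * φ x := by ring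
        _ = _ := by rw [this, hg]; ring
    simp only [h2]
    rw [integral_neg, integral_const_mul, integral_translate_sub_mul hφ hf]
    simp [smul_eq_mul]
  refine ⟨m₂, m₁, hm₂, hm₁, fun φ hφ hs => ?_⟩
  obtain ⟨c, hc, hcφ⟩ := exists_pos_isUnitTestFunction_mul hφ hs
  have h1 := key _ hcφ
  have h2 : ∀ y, fderiv ℝ (fun x => c * φ x) y = c • fderiv ℝ φ y := fun y =>
    fderiv_const_mul (hφ.differentiable (by simp) y) c
  simp only [h2, smul_apply, smul_eq_mul, integral_const_mul, mul_left_comm _ c] at h1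
  rw [← mul_sub] at h1
  exact mul_left_cancel₀ hc.ne' h1

end

/-! ### The gradient of a BV function -/

section Euclidean

variable {d : ℕ} {f : EuclideanSpace ℝ (Fin d) → ℝ}

/-- The field φ v/|v| is admissible for `gradVariation` and has divergence |v|⁻¹ ∂_v φ. -/
theorem IsBV.hasDirVariationBound (hf : IsBV f) :
    HasDirVariationBound volume f (gradVariation f).toReal := by
  intro φ hφ v
  rcases eq_or_ne v 0 with rfl | hv
  · simp
  have hn : 0 < ‖v‖ := norm_pos_iff.2 hv
  set w : EuclideanSpace ℝ (Fin d) → EuclideanSpace ℝ (Fin d) := fun x => φ x • ‖v‖⁻¹ • v with hw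
  have hdiv : ∀ x, divergence w x = ‖v‖⁻¹ * fderiv ℝ φ x v := by
    intro x
    have h1 : fderiv ℝ w x = (fderiv ℝ φ x).smulRight (‖v‖⁻¹ • v) :=
      fderiv_smul_const (hφ.differentiable x) _
    have hv' : v = ∑ i, v i • EuclideanSpace.single i (1 : ℝ) := by
      ext j; simp [Finset.sum_apply, Pi.single_apply]
    have h2 : fderiv ℝ φ x v = ∑ i, v i * fderiv ℝ φ x (EuclideanSpace.single i 1) := by
      conv_lhs => rw [hv', map_sum]
      simp only [map_smul, smul_eq_mul]
    rw [divergence, h2, Finset.mul_sum]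
    refine Finset.sum_congr rfl fun i _ => ?_
    rw [h1]
    simp only [ContinuousLinearMap.smulRight_apply, PiLp.smul_apply, smul_eq_mul]
    ring
  have hle : ENNReal.ofReal (∫ x, f x * divergence w x) ≤ gradVariation f := by
    refine le_iSup_of_le w (le_iSup_of_le (hφ.contDiff.smul contDiff_const) (le_iSup_of_le
      hφ.hasCompactSupport.smul_right (le_iSup_of_le (fun x => ?_) le_rfl)))
    rw [hw, norm_smul, norm_smul, norm_inv, norm_norm, inv_mul_cancel₀ hn.ne', mul_one]
    exact hφ.abs_le_one x
  have hle' : ∫ x, f x * divergence w x ≤ (gradVariation f).toReal :=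
    (ENNReal.ofReal_le_iff_le_toReal hf.2.ne).1 hle
  simp only [hdiv, mul_left_comm _ ‖v‖⁻¹, integral_const_mul] at hle'
  rwa [inv_mul_le_iff₀ hn, mul_comm] at hle'

/-- A function of bounded variation has a distributional gradient, and the total variations of the
components of the gradient are the directional variations. -/
theorem IsBV.exists_isDistribGradient (hf : IsBV f) :
    ∃ Df : VectorMeasure (EuclideanSpace ℝ (Fin d)) (EuclideanSpace ℝ (Fin d)),
      IsDistribGradient f Df ∧
      ∀ v, dotVariation Df v = ENNReal.ofReal (dirVariation volume f v) := by
  have hb := hf.hasDirVariationBound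
  choose m₁ m₂ hm₁ hm₂ hm using fun i : Fin d =>
    hb.exists_measure_sub hf.1 (EuclideanSpace.single i 1)
  -- A common dominating measure, so that all components of the gradient have densities and combine
  -- into one vector density `h`.
  set m : Measure (EuclideanSpace ℝ (Fin d)) := Measure.sum fun i => m₁ i + m₂ i with hmdef
  have hmfin : IsFiniteMeasure m := by rw [hmdef, Measure.sum_fintype]; infer_instance
  have hac₁ : ∀ i, m₁ i ≪ m := fun i =>
    (Measure.AbsolutelyContinuous.rfl.add_right (m₂ i)).trans
      (Measure.absolutelyContinuous_sum_right i Measure.AbsolutelyContinuous.rfl)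
  have hac₂ : ∀ i, m₂ i ≪ m := fun i =>
    (by rw [add_comm]; exact Measure.AbsolutelyContinuous.rfl.add_right (m₁ i) :
      m₂ i ≪ m₁ i + m₂ i).trans
      (Measure.absolutelyContinuous_sum_right i Measure.AbsolutelyContinuous.rfl)
  set k : Fin d → EuclideanSpace ℝ (Fin d) → ℝ := fun i x =>
    ((m₂ i).rnDeriv m x).toReal - ((m₁ i).rnDeriv m x).toReal with hk
  have hki : ∀ i, Integrable (k i) m := fun i =>
    Measure.integrable_toReal_rnDeriv.sub Measure.integrable_toReal_rnDeriv
  set h : EuclideanSpace ℝ (Fin d) → EuclideanSpace ℝ (Fin d) := fun x =>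
    ∑ i, k i x • EuclideanSpace.single i 1 with hh
  have hhi : Integrable h m := integrable_finsetSum _ fun i _ => (hki i).smul_const _
  have hinner : ∀ v x, inner ℝ v (h x) = ∑ i, v i * k i x := by
    intro v x
    simp [hh, inner_sum, inner_smul_right, mul_comm, EuclideanSpace.inner_single_right]
  have hpair : ∀ φ : EuclideanSpace ℝ (Fin d) → ℝ, ContDiff ℝ ((⊤ : ℕ∞) : WithTop ℕ∞) φ →
      HasCompactSupport φ → ∀ v,
        ∫ y, f y * fderiv ℝ φ y v = -∫ x, inner ℝ v (h x) * φ x ∂m := by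
    intro φ hφ hs v
    obtain ⟨B, hB⟩ := hs.exists_bound_of_continuous hφ.continuous
    have hki' : ∀ i, Integrable (fun x => k i x * φ x) m := fun i =>
      (hki i).mul_bdd hφ.continuous.aestronglyMeasurable (Eventually.of_forall hB)
    have hφi : ∀ (n : Measure (EuclideanSpace ℝ (Fin d))) [IsFiniteMeasure n], Integrable φ n :=
      fun n _ => Integrable.of_bound hφ.continuous.aestronglyMeasurable B (Eventually.of_forall hB)
    have hrn : ∀ n : Measure (EuclideanSpace ℝ (Fin d)), IsFiniteMeasure n → n ≪ m →
        Integrable (fun x => (n.rnDeriv m x).toReal * φ x) m ∧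
          ∫ x, (n.rnDeriv m x).toReal * φ x ∂m = ∫ x, φ x ∂n := by
      intro n hfin hn
      have : n.HaveLebesgueDecomposition m := Measure.haveLebesgueDecomposition_of_sigmaFinite n m
      exact ⟨(integrable_rnDeriv_smul_iff hn).2 (hφi n), integral_rnDeriv_smul hn⟩
    have hk' : ∀ i, ∫ x, k i x * φ x ∂m
        = -∫ y, f y * fderiv ℝ φ y (EuclideanSpace.single i 1) := by
      intro i
      rw [hm i φ hφ hs, ← (hrn _ (hm₁ i) (hac₁ i)).2, ← (hrn _ (hm₂ i) (hac₂ i)).2, neg_sub,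
        ← integral_sub (hrn _ (hm₂ i) (hac₂ i)).1 (hrn _ (hm₁ i) (hac₁ i)).1]
      simp only [hk, sub_mul]
    have hv' : v = ∑ i, v i • EuclideanSpace.single i (1 : ℝ) := by
      ext j; simp [Finset.sum_apply, Pi.single_apply]
    have h2 : ∀ y, f y * fderiv ℝ φ y v
        = ∑ i, v i * (f y * fderiv ℝ φ y (EuclideanSpace.single i 1)) := by
      intro y
      conv_lhs => rw [hv', map_sum, Finset.mul_sum]
      refine Finset.sum_congr rfl fun i _ => ?_
      rw [map_smul, smul_eq_mul, mul_left_comm]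
    simp only [h2, hinner, Finset.sum_mul, mul_assoc]
    rw [integral_finsetSum _ fun i _ => (hf.1.mul_fderiv hφ hs _).const_mul _,
      integral_finsetSum _ fun i _ => (hki' i).const_mul _, ← Finset.sum_neg_distrib]
    refine Finset.sum_congr rfl fun i _ => ?_
    rw [integral_const_mul, integral_const_mul, hk', mul_neg, neg_neg]
  have hvar : (m.withDensityᵥ h).variation = m.withDensity fun x => ‖h x‖ₑ :=
    Measure.variation_withDensityᵥ hhi
  refine ⟨m.withDensityᵥ h, fun φ hφ hs => ?_, fun v => ?_⟩
  · have hfin : IsFiniteMeasure (m.withDensityᵥ h).variation := by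
      rw [hvar]; exact isFiniteMeasure_withDensity hhi.2.ne
    obtain ⟨B, hB⟩ := hs.exists_bound_of_continuous hφ.continuous
    have hφi : Integrable φ (m.withDensityᵥ h).variation :=
      Integrable.of_bound hφ.continuous.aestronglyMeasurable B (Eventually.of_forall hB)
    rw [integral_withDensityᵥ hhi hφi]
    have hc : Continuous (fderiv ℝ φ) := hφ.continuous_fderiv (by simp)
    obtain ⟨C, hC⟩ := (hs.fderiv (𝕜 := ℝ)).exists_bound_of_continuous hc
    have hgrad : Continuous (gradient φ) :=
      (InnerProductSpace.toDual ℝ (EuclideanSpace ℝ (Fin d))).symm.continuous.comp hc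
    have hgi : Integrable fun x => f x • gradient φ x :=
      hf.1.smul_bdd (C := C) hgrad.aestronglyMeasurable (Eventually.of_forall fun x => by
        simpa [gradient] using hC x)
    refine ext_inner_left ℝ fun v => ?_
    rw [inner_neg_right, ← integral_inner hgi, ← integral_inner
      (integrable_smul_of_integrable_variation_withDensityᵥ hhi hφi)]
    simp only [inner_smul_right]
    have hg : ∀ x, inner ℝ v (gradient φ x) = fderiv ℝ φ x v := fun x => by
      rw [real_inner_comm, gradient, InnerProductSpace.toDual_symm_apply]
    simp only [hg]
    rw [hpair φ hφ hs v]
    simp only [mul_comm]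
  · have hvi : Integrable (fun x => inner ℝ v (h x)) m := hhi.const_inner v
    have hdot : dotMeasure (m.withDensityᵥ h) v = m.withDensityᵥ fun x => inner ℝ v (h x) := by
      ext s hs
      rw [withDensityᵥ_apply hvi hs]
      change inner ℝ v (m.withDensityᵥ h s) = _
      rw [withDensityᵥ_apply hhi hs]
      exact (integral_inner hhi.integrableOn v).symm
    rw [dotVariation, hdot, Measure.variation_withDensityᵥ hvi,
      withDensity_apply _ MeasurableSet.univ, Measure.restrict_univ,
      ← ofReal_integral_norm_eq_lintegral_enorm hvi]
    congr 1
    -- By `hpair`, the numbers whose supremum is V(v) are the pairings of ⟨v, h⟩ with test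
    -- functions; duality makes their supremum the L¹ norm.
    refine le_antisymm (integral_abs_le_of_forall_isUnitTestFunction hvi fun φ hφ => ?_)
      (HasDirVariationBound.dirVariation_le fun φ hφ => ?_)
    · have := (neg_le_abs _).trans (hb.abs_integral_le_dirVariation hφ v)
      rwa [hpair φ hφ.contDiff hφ.hasCompactSupport v, neg_neg] at this
    · rw [hpair φ hφ.contDiff hφ.hasCompactSupport v, ← integral_neg]
      simpa only [mul_neg, Real.norm_eq_abs] using hφ.neg.integral_mul_le hvi

end Euclidean

theorem ENNReal.tendsto_of_eventually_le_add {ι : Type*} {l : Filter ι} {a b : ι → ℝ≥0∞}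
    {L : ℝ≥0∞} (hL : L ≠ ∞) (hb : Tendsto b l (𝓝 L))
    (h : ∀ ε : ℝ≥0∞, 0 < ε → ∀ᶠ j in l, a j ≤ b j + ε ∧ b j ≤ a j + ε) :
    Tendsto a l (𝓝 L) := by
  rw [ENNReal.tendsto_nhds hL] at hb ⊢
  intro ε hε
  have hε2 : 0 < ε / 2 := ENNReal.half_pos hε.ne'
  filter_upwards [hb _ hε2, h _ hε2] with j h1 h2
  refine ⟨tsub_le_iff_right.2 ?_, ?_⟩
  · calc L ≤ b j + ε / 2 := tsub_le_iff_right.1 h1.1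
      _ ≤ a j + ε / 2 + ε / 2 := by gcongr; exact h2.2
      _ = a j + ε := by rw [add_assoc, ENNReal.add_halves]
  · calc a j ≤ b j + ε / 2 := h2.1
      _ ≤ L + ε / 2 + ε / 2 := by gcongr; exact h1.2
      _ = L + ε := by rw [add_assoc, ENNReal.add_halves]

/-! ### Normalized measures, sphere projection and energy -/

variable {d : ℕ} {ν : Measure (EuclideanSpace ℝ (Fin d))} {R : ℝ≥0∞}

theorem measurable_min_enorm : Measurable fun x : EuclideanSpace ℝ (Fin d) => min R ‖x‖ₑ :=
  measurable_const.min measurable_enorm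

/-- The weight 1 ∧ |x| is positive ν-a.e. and makes ν finite; dividing it out again exhibits ν as a
density over a finite measure. Tonelli in `nonlocalEnergy_eq` needs this. -/
theorem IsAdmissible.sFinite (hν : IsAdmissible ν) : SFinite ν := by
  have hm := measurable_min_enorm (d := d) (R := 1)
  have : IsFiniteMeasure (ν.withDensity fun x => min 1 ‖x‖ₑ) := isFiniteMeasure_withDensity hν.1.ne
  have hne : ∀ᵐ x ∂ν, min 1 ‖x‖ₑ ≠ 0 := by
    have h0 : ∀ᵐ x ∂ν, x ≠ 0 := measure_eq_zero_iff_ae_notMem.1 hν.2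
    filter_upwards [h0] with x hx
    exact (lt_min one_pos (enorm_pos.2 hx)).ne'
  rw [← withDensity_inv_same₀ hm.aemeasurable hne
    (Eventually.of_forall fun x => (min_le_left 1 ‖x‖ₑ).trans_lt ENNReal.one_lt_top |>.ne)]
  infer_instance

/-- If the constant vanished, ν would be carried by {0}, which is a null set. -/
theorem IsAdmissible.normConst_pos (hν : IsAdmissible ν) (hν0 : ν ≠ 0) (hR : 1 ≤ R) :
    0 < normConst R ν := by
  rw [pos_iff_ne_zero, normConst, Ne, lintegral_eq_zero_iff measurable_min_enorm]
  intro h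
  apply hν0
  rw [← Measure.measure_univ_eq_zero, ← nonpos_iff_eq_zero]
  have h1 : ∀ᵐ x ∂ν, x = 0 := by
    filter_upwards [h] with x hx
    have hR0 : R ≠ 0 := (zero_lt_one.trans_le hR).ne'
    rcases min_choice R ‖x‖ₑ with h2 | h2
    · exact absurd (h2.symm.trans hx) hR0
    · exact enorm_eq_zero.1 (h2.symm.trans hx)
  have h2 : ∀ᵐ x ∂ν, x ≠ 0 := measure_eq_zero_iff_ae_notMem.1 hν.2
  have h3 : ∀ᵐ _ ∂ν, False := by filter_upwards [h1, h2] with x hx hx' using hx' hx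
  simpa [ae_iff] using h3.le

theorem lintegral_normalizedMeasure {g : EuclideanSpace ℝ (Fin d) → ℝ≥0∞} (hg : Measurable g) :
    ∫⁻ x, g x ∂normalizedMeasure R ν = (normConst R ν)⁻¹ * ∫⁻ x, min R ‖x‖ₑ * g x ∂ν := by
  rw [normalizedMeasure, lintegral_smul_measure,
    lintegral_withDensity_eq_lintegral_mul _ measurable_min_enorm hg]
  rfl

theorem isProbabilityMeasure_normalizedMeasure (h0 : 0 < normConst R ν)
    (hC : normConst R ν < ∞) : IsProbabilityMeasure (normalizedMeasure R ν) := by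
  refine ⟨?_⟩
  rw [← lintegral_one, lintegral_normalizedMeasure measurable_const]
  simp only [mul_one]
  exact ENNReal.inv_mul_cancel h0.ne' hC.ne

theorem normalizedMeasure_singleton_zero : normalizedMeasure R ν {0} = 0 := by
  rw [normalizedMeasure, Measure.smul_apply, withDensity_apply _ (measurableSet_singleton 0),
    setLIntegral_eq_zero (measurableSet_singleton 0), smul_zero]
  rintro x rfl
  simp

theorem lintegral_sphereProjection {lam : Measure (EuclideanSpace ℝ (Fin d))} (h0 : lam {0} = 0)
    {W : EuclideanSpace ℝ (Fin d) → ℝ≥0∞} (hW : Measurable W) :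
    ∫⁻ θ, W θ ∂sphereProjection lam = ∫⁻ x, W (‖x‖⁻¹ • x) ∂lam := by
  rw [sphereProjection, lintegral_map
    (f := fun θ : Metric.sphere (0 : EuclideanSpace ℝ (Fin d)) 1 => W θ)
    (hW.comp measurable_subtype_coe) (by fun_prop)]
  simp only [homeomorphUnitSphereProd_apply_fst_coe]
  rw [lintegral_subtype_comap (measurableSet_singleton _).compl fun x => W (‖x‖⁻¹ • x),
    Measure.restrict_eq_self_of_ae_mem]
  exact measure_eq_zero_iff_ae_notMem.1 h0

theorem isProbabilityMeasure_sphereProjection {lam : Measure (EuclideanSpace ℝ (Fin d))}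
    [IsProbabilityMeasure lam] (h0 : lam {0} = 0) :
    IsProbabilityMeasure (sphereProjection lam) := by
  refine ⟨?_⟩
  rw [← lintegral_one, lintegral_sphereProjection h0 (W := fun _ => 1) measurable_const]
  simp

theorem nonlocalEnergy_eq [SFinite ν] {f : EuclideanSpace ℝ (Fin d) → ℝ} (hf : Integrable f) :
    nonlocalEnergy ν f = 2⁻¹ * ∫⁻ x, ENNReal.ofReal (translationIncrement volume f x) ∂ν := by
  have hmeas : AEMeasurable (Function.uncurry fun y x : EuclideanSpace ℝ (Fin d) =>
      ‖f (x + y) - f y‖ₑ) (volume.prod ν) := by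
    -- `f` is only a.e. measurable, so the addition map must pull null sets back to null sets.
    have h1 : AEStronglyMeasurable (fun p : EuclideanSpace ℝ (Fin d) × EuclideanSpace ℝ (Fin d) =>
        f (p.2 + p.1)) (volume.prod ν) :=
      hf.aestronglyMeasurable.comp_quasiMeasurePreserving
        (quasiMeasurePreserving_add_swap volume ν)
    exact (h1.sub hf.aestronglyMeasurable.comp_fst).enorm
  rw [nonlocalEnergy, lintegral_lintegral_swap hmeas]
  congr 1
  refine lintegral_congr fun x => ?_
  rw [translationIncrement]
  simp only [← Real.norm_eq_abs]
  rw [ofReal_integral_norm_eq_lintegral_enorm (hf.translate_sub x)]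
  simp only [add_comm x]

/-! ### Comparison of the energy with the sphere integral -/

section Comparison

variable {f : EuclideanSpace ℝ (Fin d) → ℝ} {M : ℝ}

/-- For |x| ≤ 1 ≤ R the weight is |x|, which homogeneity absorbs. -/
theorem min_enorm_mul_dirVariation_of_norm_le (h : HasDirVariationBound volume f M) (hR : 1 ≤ R)
    {x : EuclideanSpace ℝ (Fin d)} (hx0 : x ≠ 0) (hx : ‖x‖ ≤ 1) :
    min R ‖x‖ₑ * ENNReal.ofReal (dirVariation volume f (‖x‖⁻¹ • x))
      = ENNReal.ofReal (dirVariation volume f x) := by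
  have hn : 0 < ‖x‖ := norm_pos_iff.2 hx0
  have hw : min R ‖x‖ₑ = ENNReal.ofReal ‖x‖ := by
    rw [ofReal_norm]
    refine min_eq_right (le_trans ?_ hR)
    rw [← ofReal_norm]
    exact ENNReal.ofReal_le_one.2 hx
  rw [hw, ← ENNReal.ofReal_mul hn.le, ← h.dirVariation_smul hn, smul_inv_smul₀ hn.ne']

theorem ofReal_le_min_enorm (hR : 1 ≤ R) {δ : ℝ} (hδ : δ ≤ 1) {x : EuclideanSpace ℝ (Fin d)}
    (hx : δ < ‖x‖) : ENNReal.ofReal δ ≤ min R ‖x‖ₑ := by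
  refine le_min ((ENNReal.ofReal_le_one.2 hδ).trans hR) ?_
  rw [← ofReal_norm]
  exact ENNReal.ofReal_le_ofReal hx.le

/-- The energy is bounded by the averaged directional variation, up to the mass far from `0`. -/
theorem lintegral_translationIncrement_le (h : HasDirVariationBound volume f M)
    (hf : Integrable f) (hR : 1 ≤ R) {δ : ℝ} (hδ : 0 < δ) (hδ1 : δ ≤ 1) :
    (normConst R ν)⁻¹ * ∫⁻ x, ENNReal.ofReal (translationIncrement volume f x) ∂ν ≤
      ∫⁻ θ, ENNReal.ofReal (dirVariation volume f θ) ∂sphereProjection (normalizedMeasure R ν)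
        + ENNReal.ofReal (2 * (∫ y, |f y|) / δ)
          * normalizedMeasure R ν (Metric.closedBall 0 δ)ᶜ := by
  have hV : Measurable fun x => ENNReal.ofReal (dirVariation volume f x) :=
    (h.continuous_dirVariation hf).measurable.ennreal_ofReal
  have hV' : Measurable fun x => ENNReal.ofReal (dirVariation volume f (‖x‖⁻¹ • x)) :=
    hV.comp (measurable_norm.inv.smul measurable_id)
  have hA : MeasurableSet (Metric.closedBall (0 : EuclideanSpace ℝ (Fin d)) δ)ᶜ :=
    Metric.isClosed_closedBall.measurableSet.compl
  rw [lintegral_sphereProjection normalizedMeasure_singleton_zero hV,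
    ← lintegral_indicator_const hA, ← lintegral_add_left hV',
    lintegral_normalizedMeasure (by fun_prop (disch := exact hA))]
  gcongr with x
  rcases eq_or_ne x 0 with rfl | hx0
  · simp [translationIncrement]
  -- Near 0, G ≤ V suffices. Far away, G ≤ 2‖f‖₁ and the weight is at least δ, whence the constant
  -- 2‖f‖₁/δ.
  rcases le_or_gt ‖x‖ δ with hx | hx
  · rw [mul_add, min_enorm_mul_dirVariation_of_norm_le h hR hx0 (hx.trans hδ1)]
    exact le_add_right (ENNReal.ofReal_le_ofReal (h.translationIncrement_le_dirVariation hf x))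
  · have hxA : x ∈ (Metric.closedBall (0 : EuclideanSpace ℝ (Fin d)) δ)ᶜ := by simpa using hx
    rw [indicator_of_mem hxA, mul_add]
    refine le_add_left ?_
    calc ENNReal.ofReal (translationIncrement volume f x)
        ≤ ENNReal.ofReal (δ * (2 * (∫ y, |f y|) / δ)) := by
          rw [mul_div_cancel₀ _ hδ.ne']
          exact ENNReal.ofReal_le_ofReal (translationIncrement_le hf x)
      _ = ENNReal.ofReal δ * ENNReal.ofReal (2 * (∫ y, |f y|) / δ) := ENNReal.ofReal_mul hδ.le
      _ ≤ _ := by gcongr; exact ofReal_le_min_enorm hR hδ1 hx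

/-- The averaged directional variation is bounded by the energy, up to the mass far from `0`. -/
theorem lintegral_dirVariation_le (h : HasDirVariationBound volume f M)
    (hf : Integrable f) (hR : 1 ≤ R) (h0 : 0 < normConst R ν) (hC : normConst R ν < ∞)
    {δ η : ℝ} (hδ1 : δ ≤ 1)
    (hδη : ∀ x : EuclideanSpace ℝ (Fin d), ‖x‖ ≤ δ →
      dirVariation volume f x ≤ translationIncrement volume f x + η * ‖x‖) :
    ∫⁻ θ, ENNReal.ofReal (dirVariation volume f θ) ∂sphereProjection (normalizedMeasure R ν) ≤
      (normConst R ν)⁻¹ * ∫⁻ x, ENNReal.ofReal (translationIncrement volume f x) ∂ν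
        + (ENNReal.ofReal η + ENNReal.ofReal M
          * normalizedMeasure R ν (Metric.closedBall 0 δ)ᶜ) := by
  have hprob := isProbabilityMeasure_normalizedMeasure h0 hC
  have hV : Measurable fun x => ENNReal.ofReal (dirVariation volume f x) :=
    (h.continuous_dirVariation hf).measurable.ennreal_ofReal
  have hV' : Measurable fun x => ENNReal.ofReal (dirVariation volume f (‖x‖⁻¹ • x)) :=
    hV.comp (measurable_norm.inv.smul measurable_id)
  have hG : Measurable fun x => ENNReal.ofReal (translationIncrement volume f x) :=
    (h.continuous_translationIncrement hf).measurable.ennreal_ofReal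
  have hA : MeasurableSet (Metric.closedBall (0 : EuclideanSpace ℝ (Fin d)) δ)ᶜ :=
    Metric.isClosed_closedBall.measurableSet.compl
  -- Since λ is a probability measure, the error η|x| integrates to at most η after normalization.
  have hη' : ENNReal.ofReal η = ∫⁻ _, ENNReal.ofReal η ∂normalizedMeasure R ν := by simp
  rw [lintegral_sphereProjection normalizedMeasure_singleton_zero hV, hη',
    ← lintegral_indicator_const hA, ← lintegral_add_left measurable_const,
    lintegral_normalizedMeasure hV', lintegral_normalizedMeasure (by fun_prop (disch := exact hA)),
    ← mul_add, ← lintegral_add_left hG]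
  gcongr with x
  rcases eq_or_ne x 0 with rfl | hx0
  · simp
  have hn : 0 < ‖x‖ := norm_pos_iff.2 hx0
  rcases le_or_gt ‖x‖ δ with hx | hx
  · have hw : min R ‖x‖ₑ = ENNReal.ofReal ‖x‖ := by
      rw [ofReal_norm]
      refine min_eq_right (le_trans ?_ hR)
      rw [← ofReal_norm]
      exact ENNReal.ofReal_le_one.2 (hx.trans hδ1)
    rw [min_enorm_mul_dirVariation_of_norm_le h hR hx0 (hx.trans hδ1), mul_add]
    calc ENNReal.ofReal (dirVariation volume f x)
        ≤ ENNReal.ofReal (translationIncrement volume f x + ‖x‖ * η) :=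
          ENNReal.ofReal_le_ofReal ((hδη x hx).trans_eq (by rw [mul_comm]))
      _ ≤ ENNReal.ofReal (translationIncrement volume f x) + ENNReal.ofReal (‖x‖ * η) :=
          ENNReal.ofReal_add_le
      _ = ENNReal.ofReal (translationIncrement volume f x)
            + min R ‖x‖ₑ * ENNReal.ofReal η := by rw [ENNReal.ofReal_mul hn.le, hw]
      _ ≤ _ := by gcongr; exact le_self_add
  -- Far from 0 the increment is discarded: V ≤ M on unit vectors.
  · have hxA : x ∈ (Metric.closedBall (0 : EuclideanSpace ℝ (Fin d)) δ)ᶜ := by simpa using hx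
    rw [indicator_of_mem hxA, mul_add]
    refine le_add_left (le_add_left ?_)
    gcongr
    refine (h.dirVariation_le_mul_norm _).trans_eq ?_
    rw [norm_smul, norm_inv, norm_norm, inv_mul_cancel₀ hn.ne', mul_one]

end Comparison

end

/-! ### Passage to the limit -/

theorem theorem3p3 (d : ℕ) (ν : ℝ → Measure (EuclideanSpace ℝ (Fin d))) (R : ℝ → ℝ≥0∞)
    (hν : ∀ ε, 0 < ε → IsAdmissible (ν ε))
    (hν0 : ∀ ε, 0 < ε → ν ε ≠ 0)
    (hR : ∀ ε, 0 < ε → 1 ≤ R ε)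
    (hC : ∀ ε, 0 < ε → normConst (R ε) (ν ε) < ⊤)
    (htight : ∀ r : ℝ, 0 < r →
      Tendsto (fun ε => normalizedMeasure (R ε) (ν ε) (Metric.closedBall 0 r)ᶜ)
        (𝓝[>] (0 : ℝ)) (𝓝 0)) :
    ∃ (e : ℕ → ℝ)
      (m : ℕ → ProbabilityMeasure (Metric.sphere (0 : EuclideanSpace ℝ (Fin d)) 1))
      (μ : ProbabilityMeasure (Metric.sphere (0 : EuclideanSpace ℝ (Fin d)) 1)),
      (∀ j, 0 < e j) ∧ Tendsto e atTop (𝓝 0) ∧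
      (∀ j, (m j : Measure (Metric.sphere (0 : EuclideanSpace ℝ (Fin d)) 1)) =
        sphereProjection (normalizedMeasure (R (e j)) (ν (e j)))) ∧
      Tendsto m atTop (𝓝 μ) ∧
      ∀ f : EuclideanSpace ℝ (Fin d) → ℝ, IsBV f →
        ∃ Df : VectorMeasure (EuclideanSpace ℝ (Fin d)) (EuclideanSpace ℝ (Fin d)),
          IsDistribGradient f Df ∧
          Tendsto (fun j => (normConst (R (e j)) (ν (e j)))⁻¹ * nonlocalEnergy (ν (e j)) f)
            atTop
            (𝓝 (2⁻¹ * ∫⁻ θ, dotVariation Df (θ : EuclideanSpace ℝ (Fin d))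
              ∂(μ : Measure (Metric.sphere (0 : EuclideanSpace ℝ (Fin d)) 1)))) := by
  have hpos : ∀ ε, 0 < ε → 0 < normConst (R ε) (ν ε) := fun ε hε =>
    (hν ε hε).normConst_pos (hν0 ε hε) (hR ε hε)
  have hprob : ∀ n : ℕ, IsProbabilityMeasure (sphereProjection
      (normalizedMeasure (R (1 / ((n : ℝ) + 1))) (ν (1 / ((n : ℝ) + 1))))) := fun n => by
    have hn : (0 : ℝ) < 1 / ((n : ℝ) + 1) := Nat.one_div_pos_of_nat
    have := isProbabilityMeasure_normalizedMeasure (hpos _ hn) (hC _ hn)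
    exact isProbabilityMeasure_sphereProjection normalizedMeasure_singleton_zero
  let m₀ : ℕ → ProbabilityMeasure (Metric.sphere (0 : EuclideanSpace ℝ (Fin d)) 1) :=
    fun n => ⟨_, hprob n⟩
  -- Probability measures on the compact sphere are weakly sequentially compact. The subsequence is
  -- fixed before `f`, so it serves every `f`.
  obtain ⟨μ, σ, hσ, hlim⟩ := CompactSpace.tendsto_subseq m₀
  set e : ℕ → ℝ := fun j => 1 / ((σ j : ℝ) + 1) with he
  have he0 : ∀ j, 0 < e j := fun j => Nat.one_div_pos_of_nat
  have helim : Tendsto e atTop (𝓝 0) :=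
    (tendsto_one_div_add_atTop_nhds_zero_nat (𝕜 := ℝ)).comp hσ.tendsto_atTop
  have helim' : Tendsto e atTop (𝓝[>] 0) :=
    tendsto_nhdsWithin_iff.2 ⟨helim, Eventually.of_forall he0⟩
  refine ⟨e, m₀ ∘ σ, μ, he0, helim, fun j => rfl, hlim, fun f hf => ?_⟩
  obtain ⟨Df, hDf, hvar⟩ := hf.exists_isDistribGradient
  refine ⟨Df, hDf, ?_⟩
  have hb := hf.hasDirVariationBound
  set M := (gradVariation f).toReal
  have hEq : ∀ j, (normConst (R (e j)) (ν (e j)))⁻¹ * nonlocalEnergy (ν (e j)) f =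
      2⁻¹ * ((normConst (R (e j)) (ν (e j)))⁻¹ *
        ∫⁻ x, ENNReal.ofReal (translationIncrement volume f x) ∂ν (e j)) := fun j => by
    have := (hν _ (he0 j)).sFinite
    rw [nonlocalEnergy_eq hf.1, mul_left_comm]
  simp only [hEq, hvar]
  refine ENNReal.Tendsto.const_mul ?_ (Or.inr (by simp))
  let W : BoundedContinuousFunction (Metric.sphere (0 : EuclideanSpace ℝ (Fin d)) 1) NNReal :=
    BoundedContinuousFunction.mkOfCompact ⟨fun θ => (dirVariation volume f θ).toNNReal,
      continuous_real_toNNReal.comp ((hb.continuous_dirVariation hf.1).comp continuous_subtype_val)⟩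
  have hWlim := (ProbabilityMeasure.tendsto_iff_forall_lintegral_tendsto.1 hlim) W
  have hfin : ∫⁻ θ, ENNReal.ofReal (dirVariation volume f θ)
      ∂(μ : Measure (Metric.sphere (0 : EuclideanSpace ℝ (Fin d)) 1)) ≠ ∞ :=
    (W.lintegral_lt_top_of_nnreal (μ : Measure _)).ne
  refine ENNReal.tendsto_of_eventually_le_add hfin hWlim fun ε hε => ?_
  have hε2 : 0 < ε / 2 := ENNReal.half_pos hε.ne'
  obtain ⟨η, hη0, hηε⟩ : ∃ η : ℝ, 0 < η ∧ ENNReal.ofReal η ≤ ε / 2 := by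
    obtain ⟨η, hη0, hη⟩ := ENNReal.lt_iff_exists_nnreal_btwn.1 hε2
    exact ⟨η, by exact_mod_cast hη0, by simpa using hη.le⟩
  obtain ⟨δ', hδ'0, hδ'⟩ := hb.exists_dirVariation_le hf.1 hη0
  -- The cap at 1 keeps the weight equal to |x| on the ball of radius δ. As δ does not depend on j,
  -- the hypothesis `htight` applies to it.
  set δ := min δ' 1
  have hδ0 : 0 < δ := lt_min hδ'0 one_pos
  have hδ1 : δ ≤ 1 := min_le_right _ _
  have hsmall : ∀ K : ℝ, ∀ᶠ j in atTop, ENNReal.ofReal K *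
      normalizedMeasure (R (e j)) (ν (e j)) (Metric.closedBall 0 δ)ᶜ ≤ ε / 2 := fun K => by
    have := ENNReal.Tendsto.const_mul ((htight δ hδ0).comp helim')
      (Or.inr (ENNReal.ofReal_ne_top (r := K)))
    rw [mul_zero] at this
    exact (this.eventually (gt_mem_nhds hε2)).mono fun j hj => hj.le
  filter_upwards [hsmall (2 * (∫ y, |f y|) / δ), hsmall M] with j h1 h2
  refine ⟨(lintegral_translationIncrement_le hb hf.1 (hR _ (he0 j)) hδ0 hδ1).trans ?_,
    (lintegral_dirVariation_le hb hf.1 (hR _ (he0 j)) (hpos _ (he0 j)) (hC _ (he0 j)) hδ1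
      fun x hx => hδ' x (hx.trans (min_le_left _ _))).trans ?_⟩
  · exact add_le_add le_rfl (h1.trans ENNReal.half_le_self)
  · gcongr
    calc _ ≤ ε / 2 + ε / 2 := add_le_add hηε h2
      _ = ε := ENNReal.add_halves ε
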